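/- For $d\in\mathbb N$ let $M_d$ denote the algebra of complex $d\times d$ matrices, and for an $a\times b$ matrix $V$ let $\mathrm{Ad}_V:M_a\to M_b$, $\mathrm{Ad}_V(X)=V^*XV$. A linear map $\Phi:M_{d_1}\to M_{d_2}$ is completely positive (CP) if $\mathrm{id}_k\otimes\Phi:M_k\otimes M_{d_1}\to M_k\otimes M_{d_2}$ is positive for all $k\in\mathbb N$. A state is a positive semidefinite matrix of trace one; a state on $\mathbb C^k\otimes\mathbb C^{d}$ is separable if it lies in the closure of the convex hull of the product states $\rho_1\otimes\rho_2$; a positive operator $T$ on $\mathbb C^k\otimes\mathbb C^{d}$ is separable if $T=0$ or $T/\operatorname{tr}(T)$ is a separable state. A CP map $\Phi:M_{d_1}\to M_{d_2}$ is entanglement breaking (EB) if $(\mathrm{id}_k\otimes\Phi)(\rho)$ is separable for all $k\in\mathbb N$ and all states $\rho$ on $\mathbb C^k\otimes\mathbb C^{d_1}$. Let $\mathrm{UEB}(d_1,d_2)$ be the set of EB maps $\Phi:M_{d_1}\to M_{d_2}$ with $\Phi(I)=I$. A CP map $\Psi:M_{d_1}\to M_{d_3}$ is complementary to a CP map $\Phi:M_{d_1}\to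 M_{d_2}$ if there is a linear operator $A:\mathbb C^{d_1}\to\mathbb C^{d_2}\otimes\mathbb C^{d_3}$ such that $\Phi(T)=\operatorname{tr}_{\mathbb C^{d_3}}(ATA^*)$ and $\Psi(T)=\operatorname{tr}_{\mathbb C^{d_2}}(ATA^*)$ (partial traces) for all $T\in M_{d_1}$. A CP map $\Phi:M_{d_1}\to M_{d_2}$ is degradable if there are $d_3\in\mathbb N$ and a CP map $\Gamma:M_{d_2}\to M_{d_3}$ such that $\Gamma\circ\Phi$ is complementary to $\Phi$. A map $\Phi\in\mathrm{UEB}(d_1,d_2)$ is a $C^*$-extreme point of $\mathrm{UEB}(d_1,d_2)$ if, whenever $\Phi=\sum_{i=1}^n\mathrm{Ad}_{T_i}\circ\Phi_i$ with $\Phi_i\in\mathrm{UEB}(d_1,d_2)$ and invertible $T_i\in M_{d_2}$ satisfying $\sum_{i=1}^nT_i^*T_i=I$, there exist unitaries $U_i\in M_{d_2}$ such that $\Phi_i=\mathrm{Ad}_{U_i}\circ\Phi$ for all $1\le i\le n$. **Theorem.** Let $d_1,d_2\in\mathbb N$ and $\Phi\in\mathrm{UEB}(d_1,d_2)$. The following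 are equivalent: (i) $\Phi$ is degradable; (ii) $\Phi$ is a $C^*$-extreme point of $\mathrm{UEB}(d_1,d_2)$. -/

import Mathlib

open scoped Kronecker ComplexOrder

noncomputable section

namespace UEBMaps

/-- `M d` is the algebra of `d × d` complex matrices. -/
abbrev M (d : ℕ) : Type := Matrix (Fin d) (Fin d) ℂ

/-- The map `Ad_V : M a → M b`, `X ↦ V* X V`, for an `a × b` matrix `V`. -/
def Ad {a b : ℕ} (V : Matrix (Fin a) (Fin b) ℂ) : M a →ₗ[ℂ] M b where
  toFun X := V.conjTranspose * X * V
  map_add' X Y := by simp only [Matrix.mul_add, Matrix.add_mul]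
  map_smul' c X := by simp

/-- The map `id_k ⊗ Φ : M k ⊗ M a → M k ⊗ M b`, with `M k ⊗ M a` written as matrices indexed by
`Fin k × Fin a`: it applies `Φ` to each of the `k × k` blocks. -/
def idTensor (k : ℕ) {a b : ℕ} (Φ : M a →ₗ[ℂ] M b)
    (X : Matrix (Fin k × Fin a) (Fin k × Fin a) ℂ) :
    Matrix (Fin k × Fin b) (Fin k × Fin b) ℂ :=
  Matrix.of fun p q => Φ (Matrix.of fun r s => X (p.1, r) (q.1, s)) p.2 q.2

/-- Completely positive maps (which are the quantum operations in finite dimension):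
`id_k ⊗ Φ` is positive for every `k`. -/
def IsCP {a b : ℕ} (Φ : M a →ₗ[ℂ] M b) : Prop :=
  ∀ (k : ℕ) (X : Matrix (Fin k × Fin a) (Fin k × Fin a) ℂ),
    X.PosSemidef → (idTensor k Φ X).PosSemidef

/-- States (density matrices): positive semidefinite matrices of trace one. -/
def IsState {n : Type*} [Fintype n] (ρ : Matrix n n ℂ) : Prop :=
  ρ.PosSemidef ∧ ρ.trace = 1

/-- Separable states: the closure of the convex hull of the product states. -/
def IsSeparableState {m n : Type*} [Fintype m] [Fintype n]
    (ρ : Matrix (m × n) (m × n) ℂ) : Prop :=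
  ρ ∈ closure (convexHull ℝ
    {σ : Matrix (m × n) (m × n) ℂ |
      ∃ (ρ₁ : Matrix m m ℂ) (ρ₂ : Matrix n n ℂ), IsState ρ₁ ∧ IsState ρ₂ ∧ σ = ρ₁ ⊗ₖ ρ₂})

/-- Separable positive operators: those whose normalization `T / tr T` is a separable state, and
the zero operator (the only positive operator that cannot be normalized). -/
def IsSeparable {m n : Type*} [Fintype m] [Fintype n]
    (T : Matrix (m × n) (m × n) ℂ) : Prop :=
  T.PosSemidef ∧ (T = 0 ∨ IsSeparableState (T.trace⁻¹ • T))

/-- Entanglement breaking maps: completely positive maps such that `(id_k ⊗ Φ)(ρ)` is separable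
for every `k` and every state `ρ` on `ℂ^k ⊗ ℂ^a`. -/
def IsEntanglementBreaking {a b : ℕ} (Φ : M a →ₗ[ℂ] M b) : Prop :=
  IsCP Φ ∧ ∀ (k : ℕ) (ρ : Matrix (Fin k × Fin a) (Fin k × Fin a) ℂ),
    IsState ρ → IsSeparable (idTensor k Φ ρ)

/-- The set of unital entanglement breaking maps from `M a` to `M b`. -/
def UEB (a b : ℕ) : Set (M a →ₗ[ℂ] M b) :=
  {Φ | IsEntanglementBreaking Φ ∧ Φ 1 = 1}

/-- Partial trace over the second tensor factor. -/
def trSnd {b c : ℕ} (X : Matrix (Fin b × Fin c) (Fin b × Fin c) ℂ) : M b :=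
  Matrix.of fun i j => ∑ s, X (i, s) (j, s)

/-- Partial trace over the first tensor factor. -/
def trFst {b c : ℕ} (X : Matrix (Fin b × Fin c) (Fin b × Fin c) ℂ) : M c :=
  Matrix.of fun i j => ∑ s, X (s, i) (s, j)

/-- `Ψ` is complementary to `Φ`: both are completely positive and for one operator
`A : ℂ^a → ℂ^b ⊗ ℂ^c` the two maps are the two partial traces of `A T A*`. -/
def IsComplementary {a b c : ℕ} (Φ : M a →ₗ[ℂ] M b) (Ψ : M a →ₗ[ℂ] M c) : Prop :=
  IsCP Φ ∧ IsCP Ψ ∧ ∃ A : Matrix (Fin b × Fin c) (Fin a) ℂ, ∀ T : M a,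
    Φ T = trSnd (A * T * A.conjTranspose) ∧ Ψ T = trFst (A * T * A.conjTranspose)

/-- `Φ` is degradable: `Γ ∘ Φ` is complementary to `Φ` for some completely positive `Γ`. -/
def IsDegradable {a b : ℕ} (Φ : M a →ₗ[ℂ] M b) : Prop :=
  ∃ (c : ℕ) (Γ : M b →ₗ[ℂ] M c), IsCP Γ ∧ IsComplementary Φ (Γ ∘ₗ Φ)

/-- `C*`-extreme points of `UEB a b`: in every proper `C*`-convex decomposition of `Φ` inside
`UEB a b`, all the maps are unitarily equivalent to `Φ`. -/
def IsCStarExtremeUEB {a b : ℕ} (Φ : M a →ₗ[ℂ] M b) : Prop :=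
  Φ ∈ UEB a b ∧
    ∀ (n : ℕ) (T : Fin n → M b) (Ψ : Fin n → (M a →ₗ[ℂ] M b)),
      (∀ i, IsUnit (T i)) → (∑ i, (T i).conjTranspose * T i = 1) → (∀ i, Ψ i ∈ UEB a b) →
      (Φ = ∑ i, Ad (T i) ∘ₗ Ψ i) →
      ∀ i, ∃ U ∈ Matrix.unitaryGroup (Fin b) ℂ, Ψ i = Ad U ∘ₗ Φ

end UEBMaps

end

/-! The proof goes through a third property: `Φ` is unitarily equivalent to a measurement in pure
states, `Φ(X) = E diag(⟨w_j, X w_j⟩) E*` with `E` unitary and `w_j` unit vectors.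

*Holevo form.* An entanglement breaking map is a finite sum `Φ(X) = ∑ ⟨u_k, X u_k⟩ v_k v_k*`
(`IsEntanglementBreaking.exists_hasHolevoForm`): its Choi matrix is separable, and the closure in
the definition of separability is harmless by compactness. The converse is
`HasHolevoForm.isEntanglementBreaking`.

*Similarity is enough.* If an invertible `G` intertwines a unital map in Holevo form with the
measurement `Λ(X) = diag(⟨w_j, X w_j⟩)`, then so does a unitary, because both maps preserve adjoints
and hence `G G*` commutes with `Λ` (`HasHolevoForm.exists_unitary`).

*Degradable maps.* A separable operator has at least the rank of its marginal. If `Φ` is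
degradable, this applies to the Choi matrices of `Φ` and its complement `Γ ∘ Φ`, and forces the
Choi rank of `Φ` to be at most `d₂` (`HasHolevoForm.rank_choi_le_of_isDegradable`). Then the vectors
`conj u_k ⊗ v_k` are spanned by `d₂` of them whose `v_k` form a basis, and the inverse of
this basis matrix is an intertwiner as above (`HasHolevoForm.exists_unitary_of_rank_le`).
Conversely, a measurement in pure states is complementary to itself.

*`C*`-extreme points.* If `Φ = ∑ Ad_{T_i} ∘ Φ_i` with `Φ` a measurement in pure states, positivity
makes `E* T_i*` an intertwiner of `Φ_i` with the same `Λ`, so that `Φ_i` and `Φ` are unitarily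
equivalent (`HasHolevoForm.isCStarExtremeUEB`). Conversely, every unital map in Holevo form is a
`C*`-convex combination of two maps one of which is a measurement in pure states
(`HasHolevoForm.exists_unitary_of_isCStarExtremeUEB`). -/

noncomputable section

namespace UEBMaps

open Matrix

/-! ### Holevo forms and similarity -/

/-- The measurement `X ↦ diag(⟨u_k, X u_k⟩)_k` given by a finite family of vectors `u_k`. -/
def pureDiag {a : ℕ} {ι : Type*} [DecidableEq ι] (u : ι → Fin a → ℂ) :
    M a →ₗ[ℂ] Matrix ι ι ℂ where
  toFun X := diagonal fun k => star (u k) ⬝ᵥ X *ᵥ u k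
  map_add' X Y := by simp [add_mulVec, dotProduct_add]
  map_smul' c X := by
    ext i j
    by_cases h : i = j <;> simp [smul_mulVec, diagonal, h]

/-- The map `X ↦ ∑ₖ ⟨u_k, X u_k⟩ v_k v_k*`, where the vectors `v_k` are the columns of `V`. -/
def holevoMap {a b : ℕ} {ι : Type*} [Fintype ι] [DecidableEq ι]
    (u : ι → Fin a → ℂ) (V : Matrix (Fin b) ι ℂ) : M a →ₗ[ℂ] M b where
  toFun X := V * pureDiag u X * Vᴴ
  map_add' X Y := by simp only [map_add, Matrix.mul_add, Matrix.add_mul]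
  map_smul' c X := by simp

/-- The Holevo form `Φ(X) = ∑ₖ ⟨u_k, X u_k⟩ v_k v_k*` with unit vectors `u_k`; the vectors `v_k`,
of arbitrary length, are the columns of `V`. -/
def HasHolevoForm {a b : ℕ} {ι : Type*} [Fintype ι] [DecidableEq ι] (Φ : M a →ₗ[ℂ] M b)
    (u : ι → Fin a → ℂ) (V : Matrix (Fin b) ι ℂ) : Prop :=
  (∀ k, star (u k) ⬝ᵥ u k = 1) ∧ ∀ X, Φ X = V * pureDiag u X * Vᴴ

/-- The Choi matrix of `Φ`, whose `(r, s)` block is `Φ(E_{rs})`. -/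
def choi {a b : ℕ} (Φ : M a →ₗ[ℂ] M b) : Matrix (Fin a × Fin b) (Fin a × Fin b) ℂ :=
  Matrix.of fun p q => Φ (single p.1 q.1 1) p.2 q.2

variable {a b : ℕ} {ι : Type*}

section pureDiag

variable [DecidableEq ι]

theorem pureDiag_apply (u : ι → Fin a → ℂ) (X : M a) :
    pureDiag u X = diagonal fun k => star (u k) ⬝ᵥ X *ᵥ u k := rfl

theorem pureDiag_one {u : ι → Fin a → ℂ} (hu : ∀ k, star (u k) ⬝ᵥ u k = 1) :
    pureDiag u 1 = 1 := by
  simp [pureDiag_apply, hu]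

theorem pureDiag_conjTranspose (u : ι → Fin a → ℂ) (X : M a) :
    (pureDiag u X)ᴴ = pureDiag u Xᴴ := by
  simp only [pureDiag_apply, diagonal_conjTranspose]
  congr 1
  ext k
  rw [Pi.star_apply, star_dotProduct, star_star, star_mulVec, ← dotProduct_mulVec]

end pureDiag

theorem quadForm_single (u : Fin a → ℂ) (p q : Fin a) :
    star u ⬝ᵥ single p q (1 : ℂ) *ᵥ u = star (u p) * u q := by
  simp [dotProduct, mulVec, single, ite_and]

section HasHolevoForm

variable [Fintype ι] [DecidableEq ι]

theorem HasHolevoForm.map_one {Φ : M a →ₗ[ℂ] M b} {u : ι → Fin a → ℂ}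
    {V : Matrix (Fin b) ι ℂ} (h : HasHolevoForm Φ u V) : Φ 1 = V * Vᴴ := by
  rw [h.2, pureDiag_one h.1, Matrix.mul_one]

theorem HasHolevoForm.map_conjTranspose {Φ : M a →ₗ[ℂ] M b} {u : ι → Fin a → ℂ}
    {V : Matrix (Fin b) ι ℂ} (h : HasHolevoForm Φ u V) (X : M a) : (Φ X)ᴴ = Φ Xᴴ := by
  simp [h.2, pureDiag_conjTranspose, conjTranspose_mul, Matrix.mul_assoc]

/-- Parallel unit vectors define the same pure state. -/
theorem quadForm_eq_of_smul_eq {u y : Fin a → ℂ} (hu : star u ⬝ᵥ u = 1)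
    (hy : star y ⬝ᵥ y = 1) {α β : ℂ} (hα : α ≠ 0) (h : α • y = β • u) (X : M a) :
    star y ⬝ᵥ X *ᵥ y = star u ⬝ᵥ X *ᵥ u := by
  have key : ∀ Z : M a, (star α * α) * (star y ⬝ᵥ Z *ᵥ y) =
      (star β * β) * (star u ⬝ᵥ Z *ᵥ u) := by
    intro Z
    have := congrArg (fun w => star w ⬝ᵥ Z *ᵥ w) h
    simp only [star_smul, mulVec_smul, smul_dotProduct, dotProduct_smul, smul_eq_mul] at this
    linear_combination this
  have h1 := key 1
  simp only [one_mulVec, hu, hy, mul_one] at h1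
  have h2 := key X
  rw [← h1] at h2
  exact mul_left_cancel₀ (mul_ne_zero (star_ne_zero.2 hα) hα) h2

open scoped MatrixOrder Matrix.Norms.L2Operator in
/-- A positive definite matrix has an invertible self-adjoint square root commuting with all
matrices the matrix itself commutes with. -/
theorem exists_sqrt {D : M b} (hD : D.PosDef) :
    ∃ R : M b, IsUnit R ∧ Rᴴ = R ∧ R * R = D ∧ ∀ Y, Commute D Y → Commute R Y := by
  have h0 : 0 ≤ D := hD.posSemidef.nonneg
  have hR : CFC.sqrt D * CFC.sqrt D = D := CFC.sqrt_mul_sqrt_self D h0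
  refine ⟨CFC.sqrt D, ?_, (CFC.sqrt_nonneg D).posSemidef.1, hR, ?_⟩
  · have := hD.isUnit
    rw [← hR] at this
    exact isUnit_of_mul_isUnit_left this
  · intro Y hY
    exact Commute.cfcₙ_nnreal hY _

/-- The mechanism of the whole argument. If an invertible `G` sends each column `z_k` of `Z` into
the span of those basis vectors `e_j` whose vector `u_j` gives the same pure state as `y_k`, then
`G` intertwines `Ψ` with the measurement `Λ` of the `u_j`. As both maps preserve adjoints, the
similarity can be made unitary by polar decomposition of `G`. -/
theorem HasHolevoForm.exists_unitary {Ψ : M a →ₗ[ℂ] M b} {y : ι → Fin a → ℂ}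
    {Z : Matrix (Fin b) ι ℂ} (h : HasHolevoForm Ψ y Z) (h1 : Ψ 1 = 1) {G : M b} (hG : IsUnit G)
    {u : Fin b → Fin a → ℂ}
    (hu : ∀ j k, (G * Z) j k ≠ 0 → ∀ X : M a, star (y k) ⬝ᵥ X *ᵥ y k = star (u j) ⬝ᵥ X *ᵥ u j) :
    ∃ E ∈ unitaryGroup (Fin b) ℂ, ∀ X, Ψ X = E * pureDiag u X * Eᴴ := by
  have hGZ : ∀ X, (G * Z) * pureDiag y X = pureDiag u X * (G * Z) := by
    intro X
    ext j k
    rw [pureDiag_apply, pureDiag_apply, mul_diagonal, diagonal_mul]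
    by_cases hjk : (G * Z) j k = 0
    · simp [hjk]
    · rw [hu j k hjk X, mul_comm]
  have hint : ∀ X, G * Ψ X = pureDiag u X * G := by
    intro X
    have hZ : Z * Zᴴ = 1 := by rw [← h.map_one, h1]
    rw [h.2, ← Matrix.mul_assoc, ← Matrix.mul_assoc, hGZ, Matrix.mul_assoc, Matrix.mul_assoc, hZ,
      Matrix.mul_one]
  have hint' : ∀ X, Ψ X * Gᴴ = Gᴴ * pureDiag u X := by
    intro X
    have := congrArg conjTranspose (hint Xᴴ)
    rwa [conjTranspose_mul, conjTranspose_mul, h.map_conjTranspose, pureDiag_conjTranspose,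
      conjTranspose_conjTranspose] at this
  have hcomm : ∀ X, Commute (G * Gᴴ) (pureDiag u X) := by
    intro X
    change G * Gᴴ * _ = _ * (G * Gᴴ)
    rw [Matrix.mul_assoc, ← hint', ← Matrix.mul_assoc, hint, Matrix.mul_assoc]
  have hpos : (G * Gᴴ).PosDef := by
    rw [(posSemidef_self_mul_conjTranspose G).posDef_iff_isUnit]
    exact hG.mul hG.star
  obtain ⟨R, hRu, hRs, hRR, hRc⟩ := exists_sqrt hpos
  have hRd := (isUnit_iff_isUnit_det R).1 hRu
  have hR1 : R⁻¹ * R = 1 := nonsing_inv_mul R hRd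
  have hR2 : R * R⁻¹ = 1 := mul_nonsing_inv R hRd
  have hRi : (R⁻¹)ᴴ = R⁻¹ := by rw [conjTranspose_nonsing_inv, hRs]
  have hE : (Gᴴ * R⁻¹) ∈ unitaryGroup (Fin b) ℂ := by
    rw [mem_unitaryGroup_iff', star_eq_conjTranspose, conjTranspose_mul, hRi,
      conjTranspose_conjTranspose]
    calc R⁻¹ * G * (Gᴴ * R⁻¹) = R⁻¹ * (G * Gᴴ) * R⁻¹ := by simp only [Matrix.mul_assoc]
      _ = (R⁻¹ * R) * (R * R⁻¹) := by rw [← hRR]; simp only [Matrix.mul_assoc]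
      _ = 1 := by rw [hR1, hR2, Matrix.mul_one]
  refine ⟨_, hE, fun X => ?_⟩
  have hRX : R * pureDiag u X = pureDiag u X * R := hRc _ (hcomm X)
  have hRX' : R⁻¹ * pureDiag u X = pureDiag u X * R⁻¹ := by
    calc R⁻¹ * pureDiag u X = R⁻¹ * (pureDiag u X * R) * R⁻¹ := by
          rw [Matrix.mul_assoc, Matrix.mul_assoc, hR2, Matrix.mul_one]
      _ = pureDiag u X * R⁻¹ := by
          rw [← hRX, ← Matrix.mul_assoc, hR1, Matrix.one_mul]
  rw [mem_unitaryGroup_iff, star_eq_conjTranspose] at hE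
  rw [Matrix.mul_assoc Gᴴ, hRX', ← Matrix.mul_assoc, ← hint', Matrix.mul_assoc (Ψ X),
    Matrix.mul_assoc, hE, Matrix.mul_one]

end HasHolevoForm

/-! ### Ranks of Choi matrices -/

/-- The matrix with columns `conj u_k ⊗ v_k`, a square root of the Choi matrix of a Holevo form. -/
def holevoRoot (u : ι → Fin a → ℂ) (V : Matrix (Fin b) ι ℂ) : Matrix (Fin a × Fin b) ι ℂ :=
  Matrix.of fun p k => star (u k p.1) * V p.2 k

theorem linearIndependent_holevoRoot_col {κ : Type*} [Fintype κ] {u : ι → Fin a → ℂ}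
    (hu : ∀ k, star (u k) ⬝ᵥ u k = 1) {V : Matrix (Fin b) ι ℂ} {f : κ → ι}
    (hf : LinearIndependent ℂ (V.col ∘ f)) :
    LinearIndependent ℂ ((holevoRoot u V).col ∘ f) := by
  rw [Fintype.linearIndependent_iff] at hf ⊢
  intro g hg s
  have h1 : ∀ r, g s * star (u (f s) r) = 0 := by
    intro r
    refine hf (fun s => g s * star (u (f s) r)) ?_ s
    ext i
    have := congrFun hg (r, i)
    simp only [Finset.sum_apply, Pi.smul_apply, Function.comp, col_apply, smul_eq_mul,
      holevoRoot, of_apply, Pi.zero_apply] at this ⊢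
    rw [← this]
    exact Finset.sum_congr rfl fun _ _ => by ring
  have h2 : g s * (star (u (f s)) ⬝ᵥ u (f s)) = 0 := by
    simp only [dotProduct, Finset.mul_sum, Pi.star_apply]
    exact Finset.sum_eq_zero fun r _ => by rw [← mul_assoc, h1, zero_mul]
  rwa [hu, mul_one] at h2

section HasHolevoForm

variable [Fintype ι] [DecidableEq ι]

theorem choi_holevoMap (u : ι → Fin a → ℂ) (V : Matrix (Fin b) ι ℂ) :
    choi (holevoMap u V) = holevoRoot u V * (holevoRoot u V)ᴴ := by
  ext p q
  rw [choi, of_apply, holevoMap, LinearMap.coe_mk, AddHom.coe_mk, pureDiag_apply, mul_apply,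
    mul_apply]
  refine Finset.sum_congr rfl fun k _ => ?_
  rw [mul_diagonal, quadForm_single]
  simp [holevoRoot]
  ring

theorem HasHolevoForm.choi_eq {Φ : M a →ₗ[ℂ] M b} {u : ι → Fin a → ℂ}
    {V : Matrix (Fin b) ι ℂ} (h : HasHolevoForm Φ u V) :
    choi Φ = holevoRoot u V * (holevoRoot u V)ᴴ := by
  rw [← choi_holevoMap, show Φ = holevoMap u V from LinearMap.ext h.2]

theorem HasHolevoForm.rank_choi {Φ : M a →ₗ[ℂ] M b} {u : ι → Fin a → ℂ}
    {V : Matrix (Fin b) ι ℂ} (h : HasHolevoForm Φ u V) :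
    (choi Φ).rank = Module.finrank ℂ (Submodule.span ℂ (Set.range (holevoRoot u V).col)) := by
  rw [h.choi_eq, rank_self_mul_conjTranspose, rank_eq_finrank_span_cols]

/-- The rank of a separable operator (here the Choi matrix of `Φ`) is at least the rank of its
second marginal `Φ 1`. -/
theorem HasHolevoForm.rank_map_one_le {Φ : M a →ₗ[ℂ] M b} {u : ι → Fin a → ℂ}
    {V : Matrix (Fin b) ι ℂ} (h : HasHolevoForm Φ u V) : (Φ 1).rank ≤ (choi Φ).rank := by
  obtain ⟨κ, f, hf, hs, hli⟩ := exists_linearIndependent' ℂ V.col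
  have := Fintype.ofInjective f hf
  have hw := linearIndependent_holevoRoot_col h.1 hli
  rw [h.map_one, rank_self_mul_conjTranspose, rank_eq_finrank_span_cols, h.rank_choi, ← hs,
    finrank_span_eq_card hli, ← finrank_span_eq_card hw]
  exact Submodule.finrank_mono (Submodule.span_mono (Set.range_comp_subset_range _ _))

/-- The vectors `v_k` of a Holevo form of a unital map contain a basis. -/
theorem HasHolevoForm.exists_basis {Φ : M a →ₗ[ℂ] M b} {u : ι → Fin a → ℂ}
    {V : Matrix (Fin b) ι ℂ} (h : HasHolevoForm Φ u V) (h1 : Φ 1 = 1) :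
    ∃ f : Fin b → ι, Function.Injective f ∧ LinearIndependent ℂ (V.col ∘ f) ∧
      IsUnit (V.submatrix id f) := by
  obtain ⟨κ, f, hf, hs, hli⟩ := exists_linearIndependent' ℂ V.col
  have := Fintype.ofInjective f hf
  have hc : Fintype.card κ = b := by
    rw [← finrank_span_eq_card hli, hs, ← rank_eq_finrank_span_cols,
      ← rank_self_mul_conjTranspose, ← h.map_one, h1, rank_one, Fintype.card_fin]
  let e : Fin b ≃ κ := (Fintype.equivFinOfCardEq hc).symm
  have hli' : LinearIndependent ℂ (V.col ∘ (f ∘ e)) := hli.comp e e.injective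
  refine ⟨f ∘ e, hf.comp e.injective, hli', ?_⟩
  rw [← linearIndependent_cols_iff_isUnit]
  exact hli'

/-- A unital map of Holevo form whose Choi rank is at most (hence equal to) `b` is unitarily
equivalent to a measurement in pure states. -/
theorem HasHolevoForm.exists_unitary_of_rank_le {Φ : M a →ₗ[ℂ] M b} {u : ι → Fin a → ℂ}
    {V : Matrix (Fin b) ι ℂ} (h : HasHolevoForm Φ u V) (h1 : Φ 1 = 1)
    (hr : (choi Φ).rank ≤ b) :
    ∃ (w : Fin b → Fin a → ℂ) (E : M b), E ∈ unitaryGroup (Fin b) ℂ ∧ HasHolevoForm Φ w E := by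
  obtain ⟨f, -, hli, hB⟩ := h.exists_basis h1
  have hw := linearIndependent_holevoRoot_col h.1 hli
  -- By the rank bound, the columns `conj u_k ⊗ v_k` chosen by `f` span all of them.
  have hspan : Submodule.span ℂ (Set.range ((holevoRoot u V).col ∘ f)) =
      Submodule.span ℂ (Set.range (holevoRoot u V).col) := by
    refine Submodule.eq_of_le_of_finrank_le
      (Submodule.span_mono (Set.range_comp_subset_range _ _)) ?_
    rw [← h.rank_choi, finrank_span_eq_card hw, Fintype.card_fin]
    exact hr
  have hBd := (isUnit_iff_isUnit_det _).1 hB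
  obtain ⟨E, hE, hΦ⟩ := h.exists_unitary h1 (G := (V.submatrix id f)⁻¹)
    (isUnit_nonsing_inv_iff.2 hB) (u := u ∘ f) (by
      intro j k hjk X
      have hk : (holevoRoot u V).col k ∈
          Submodule.span ℂ (Set.range ((holevoRoot u V).col ∘ f)) := by
        rw [hspan]; exact Submodule.subset_span ⟨k, rfl⟩
      obtain ⟨c, hc⟩ := (Submodule.mem_span_range_iff_exists_fun ℂ).1 hk
      -- Apply `1 ⊗ G` to the expansion of `conj u_k ⊗ v_k`, and compare the `j`-th components.
      have hcomp : ∀ r, ((V.submatrix id f)⁻¹ * V) j k * star (u k r) =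
          c j * star (u (f j) r) := by
        intro r
        have hVk : ∀ i, V i k * star (u k r) =
            (V.submatrix id f *ᵥ fun s => c s * star (u (f s) r)) i := by
          intro i
          have := congrFun hc (r, i)
          simp only [Finset.sum_apply, Pi.smul_apply, Function.comp, col_apply, smul_eq_mul,
            holevoRoot, of_apply] at this
          rw [mul_comm, ← this, mulVec, dotProduct]
          exact Finset.sum_congr rfl fun s _ => by simp; ring
        calc ((V.submatrix id f)⁻¹ * V) j k * star (u k r)
            = ((V.submatrix id f)⁻¹ *ᵥ fun i => V i k * star (u k r)) j := by
              rw [mul_apply, mulVec, dotProduct, Finset.sum_mul]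
              exact Finset.sum_congr rfl fun i _ => by ring
          _ = c j * star (u (f j) r) := by
              rw [funext hVk, mulVec_mulVec, nonsing_inv_mul _ hBd, one_mulVec]
      refine quadForm_eq_of_smul_eq (h.1 _) (h.1 k) (star_ne_zero.2 hjk)
        (β := star (c j)) ?_ X
      ext r
      have := congrArg star (hcomp r)
      simpa [mul_comm] using this)
  exact ⟨u ∘ f, E, hE, fun k => h.1 _, hΦ⟩

end HasHolevoForm

/-! ### Separable operators -/

/-- In finite dimension the convex hull of a compact set is compact: by Carathéodory's theorem it
is the image of a compact set of weights and points. -/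
theorem isCompact_convexHull_of_finiteDimensional {E : Type*} [AddCommGroup E] [Module ℝ E]
    [TopologicalSpace E] [ContinuousAdd E] [ContinuousSMul ℝ E] [FiniteDimensional ℝ E]
    {s : Set E} (hs : IsCompact s) : IsCompact (convexHull ℝ s) := by
  rcases s.eq_empty_or_nonempty with rfl | ⟨z₀, hz₀⟩
  · simp
  set N := Module.finrank ℝ E + 1
  have hK : IsCompact (stdSimplex ℝ (Fin N) ×ˢ Set.univ.pi fun _ : Fin N => s) :=
    (isCompact_stdSimplex ℝ (Fin N)).prod (isCompact_univ_pi fun _ => hs)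
  have hf : Continuous fun q : (Fin N → ℝ) × (Fin N → E) => ∑ i, q.1 i • q.2 i := by fun_prop
  convert hK.image hf using 1
  ext x
  constructor
  · intro hx
    obtain ⟨κ, _, z, w, hz, hai, hw, hw1, hx⟩ := eq_pos_convex_span_of_mem_convexHull hx
    have hcard : Fintype.card κ ≤ Fintype.card (Fin N) := by
      rw [Fintype.card_fin]
      exact hai.card_le_finrank_succ.trans
        (Nat.add_le_add_right (Submodule.finrank_le _) 1)
    obtain ⟨e⟩ := Function.Embedding.nonempty_of_card_le hcard
    have hext : ∀ i, Function.extend e w 0 (e i) = w i := e.injective.extend_apply _ _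
    have hext' : ∀ i, Function.extend e z (fun _ => z₀) (e i) = z i :=
      e.injective.extend_apply _ _
    have hout : ∀ i, i ∉ Set.range e → Function.extend e w 0 i = 0 := fun i hi =>
      Function.extend_apply' _ _ _ hi
    refine ⟨(Function.extend e w 0, Function.extend e z fun _ => z₀), ⟨⟨fun i => ?_, ?_⟩,
      fun i _ => ?_⟩, ?_⟩
    · by_cases hi : i ∈ Set.range e
      · obtain ⟨k, rfl⟩ := hi
        exact (hw k).le.trans_eq (hext k).symm
      · exact (hout i hi).ge
    · rw [← hw1]
      exact (Fintype.sum_of_injective e e.injective _ _ hout fun i => (hext i).symm).symm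
    · by_cases hi : i ∈ Set.range e
      · obtain ⟨k, rfl⟩ := hi
        exact Set.mem_of_eq_of_mem (hext' k) (hz ⟨k, rfl⟩)
      · exact Set.mem_of_eq_of_mem (Function.extend_apply' z (fun _ => z₀) i hi) hz₀
    · rw [← hx]
      refine (Fintype.sum_of_injective e e.injective _ _ (fun i hi => ?_) fun i => ?_).symm
      · simp only [hout i hi, zero_smul]
      · simp only [hext, hext']
  · rintro ⟨⟨w, z⟩, ⟨hw, hz⟩, rfl⟩
    exact mem_convexHull_of_exists_fintype w z hw.1 hw.2 (fun i => hz i trivial) rfl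

section Separable

variable {m n : Type*} [Fintype m] [Fintype n]

open scoped MatrixOrder in
theorem _root_.Matrix.PosSemidef.exists_eq_conjTranspose_mul_self {ρ : Matrix m m ℂ}
    (hρ : ρ.PosSemidef) : ∃ B : Matrix m m ℂ, ρ = Bᴴ * B := by
  classical
  exact CStarAlgebra.nonneg_iff_eq_star_mul_self.mp hρ.nonneg

theorem isCompact_setOf_isState : IsCompact {ρ : Matrix m m ℂ | IsState ρ} := by
  classical
  -- A state is `B* B` with `tr (B* B) = 1`, so that all entries of `B` lie in the unit disc.
  have hc : IsCompact {B : Matrix m m ℂ | (Bᴴ * B).trace = 1} := by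
    have hball : IsCompact (Set.univ.pi fun _ : m => Set.univ.pi fun _ : m =>
        Metric.closedBall (0 : ℂ) 1) :=
      isCompact_univ_pi fun _ => isCompact_univ_pi fun _ => isCompact_closedBall _ _
    refine hball.of_isClosed_subset (isClosed_eq (by fun_prop) continuous_const) ?_
    intro (B : Matrix m m ℂ) (hB : (Bᴴ * B).trace = 1) i _ j _
    rw [mem_closedBall_zero_iff]
    have htr : ∑ j, ∑ i, ‖B i j‖ ^ 2 = 1 := by
      have : (((∑ j, ∑ i, ‖B i j‖ ^ 2 : ℝ)) : ℂ) = 1 := by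
        rw [← hB]
        push_cast
        simp [trace, mul_apply, Complex.conj_mul']
      exact_mod_cast this
    have hle : ‖B i j‖ ^ 2 ≤ 1 := by
      rw [← htr]
      refine le_trans ?_ (Finset.single_le_sum (f := fun j => ∑ i, ‖B i j‖ ^ 2)
        (fun _ _ => by positivity) (Finset.mem_univ j))
      exact Finset.single_le_sum (f := fun i => ‖B i j‖ ^ 2)
        (fun _ _ => by positivity) (Finset.mem_univ i)
    exact (sq_le_one_iff₀ (norm_nonneg _)).1 hle
  convert hc.image (f := fun B : Matrix m m ℂ => Bᴴ * B) (by fun_prop) using 1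
  ext ρ
  constructor
  · rintro ⟨h1, h2⟩
    obtain ⟨B, rfl⟩ := h1.exists_eq_conjTranspose_mul_self
    exact ⟨B, h2, rfl⟩
  · rintro ⟨B, hB, rfl⟩
    exact ⟨posSemidef_conjTranspose_mul_self B, hB⟩

/-- A separable operator is a finite sum of tensor products of positive operators; the closure in
the definition adds nothing, as the product states form a compact set. -/
theorem IsSeparable.exists_eq_sum {T : Matrix (m × n) (m × n) ℂ} (hT : IsSeparable T) :
    ∃ (ι : Type) (_ : Fintype ι) (P : ι → Matrix m m ℂ) (Q : ι → Matrix n n ℂ),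
      (∀ i, (P i).PosSemidef) ∧ (∀ i, (Q i).PosSemidef) ∧ T = ∑ i, P i ⊗ₖ Q i := by
  obtain ⟨hpos, rfl | hsep⟩ := hT
  · exact ⟨Empty, inferInstance, fun _ => 0, fun _ => 0, by simp, by simp, by simp⟩
  by_cases ht : T.trace = 0
  · rw [hpos.trace_eq_zero_iff] at ht
    exact ⟨Empty, inferInstance, fun _ => 0, fun _ => 0, by simp, by simp, by simp [ht]⟩
  have hcomp : IsCompact {σ : Matrix (m × n) (m × n) ℂ |
      ∃ (ρ₁ : Matrix m m ℂ) (ρ₂ : Matrix n n ℂ), IsState ρ₁ ∧ IsState ρ₂ ∧ σ = ρ₁ ⊗ₖ ρ₂} := by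
    have hf : Continuous fun q : Matrix m m ℂ × Matrix n n ℂ => q.1 ⊗ₖ q.2 := by
      refine continuous_matrix fun i j => ?_
      simp only [kroneckerMap_apply]
      fun_prop
    convert (isCompact_setOf_isState.prod isCompact_setOf_isState).image hf using 1
    ext σ
    constructor
    · rintro ⟨ρ₁, ρ₂, h1, h2, rfl⟩
      exact ⟨(ρ₁, ρ₂), ⟨h1, h2⟩, rfl⟩
    · rintro ⟨⟨ρ₁, ρ₂⟩, ⟨h1, h2⟩, rfl⟩
      exact ⟨ρ₁, ρ₂, h1, h2, rfl⟩
  rw [IsSeparableState, (isCompact_convexHull_of_finiteDimensional hcomp).isClosed.closure_eq,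
    mem_convexHull_iff_exists_fintype] at hsep
  obtain ⟨ι, _, w, z, hw, -, hz, hsum⟩ := hsep
  choose P Q hP hQ hPQ using hz
  refine ⟨ι, inferInstance, fun i => (T.trace * (w i : ℂ)) • P i, Q, fun i => ?_,
    fun i => (hQ i).1, ?_⟩
  · exact (hP i).1.smul (mul_nonneg hpos.trace_nonneg (by exact_mod_cast hw i))
  · calc T = T.trace • (T.trace⁻¹ • T) := by rw [smul_smul, mul_inv_cancel₀ ht, one_smul]
      _ = _ := by
        rw [← hsum, Finset.smul_sum]
        refine Finset.sum_congr rfl fun i _ => ?_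
        rw [hPQ, smul_kronecker, mul_smul]
        rfl

theorem isSeparable_sum_kronecker {ι : Type*} [Fintype ι] {P : ι → Matrix m m ℂ}
    {Q : ι → Matrix n n ℂ} (hP : ∀ i, (P i).PosSemidef) (hQ : ∀ i, (Q i).PosSemidef) :
    IsSeparable (∑ i, P i ⊗ₖ Q i) := by
  classical
  have hpos : (∑ i, P i ⊗ₖ Q i).PosSemidef :=
    posSemidef_sum _ fun i _ => (hP i).kronecker (hQ i)
  refine ⟨hpos, or_iff_not_imp_left.2 fun h0 => subset_closure ?_⟩
  set T := ∑ i, P i ⊗ₖ Q i with hT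
  have hP0 : ∀ i, 0 ≤ (P i).trace := fun i => (hP i).trace_nonneg
  have hQ0 : ∀ i, 0 ≤ (Q i).trace := fun i => (hQ i).trace_nonneg
  have ht : T.trace ≠ 0 := fun h => h0 (hpos.trace_eq_zero_iff.1 h)
  have htr : T.trace = ∑ i, (P i).trace * (Q i).trace := by
    rw [hT, trace_sum]
    exact Finset.sum_congr rfl fun i _ => trace_kronecker _ _
  set w : ι → ℂ := fun i => T.trace⁻¹ * ((P i).trace * (Q i).trace) with hwdef
  have hw0 : ∀ i, 0 ≤ w i := fun i =>
    mul_nonneg (inv_nonneg.2 hpos.trace_nonneg) (mul_nonneg (hP0 i) (hQ0 i))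
  have hwre : ∀ i, ((w i).re : ℂ) = w i := fun i => by
    apply Complex.ext <;> simp [← (Complex.nonneg_iff.1 (hw0 i)).2]
  have hw1 : ∑ i, (w i).re = 1 := by
    rw [← Complex.re_sum, hwdef, ← Finset.mul_sum, ← htr, inv_mul_cancel₀ ht, Complex.one_re]
  -- Only the terms of nonzero weight can be normalized.
  have hmem := (convex_convexHull ℝ {σ : Matrix (m × n) (m × n) ℂ |
      ∃ (ρ₁ : Matrix m m ℂ) (ρ₂ : Matrix n n ℂ), IsState ρ₁ ∧ IsState ρ₂ ∧
        σ = ρ₁ ⊗ₖ ρ₂}).sum_mem (t := Finset.univ.filter fun i => (w i).re ≠ 0)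
      (w := fun i => (w i).re)
      (z := fun i => ((P i).trace⁻¹ • P i) ⊗ₖ ((Q i).trace⁻¹ • Q i))
      (fun i _ => (Complex.nonneg_iff.1 (hw0 i)).1)
      (by rw [Finset.sum_filter_ne_zero, hw1])
      (fun i hi => by
        have hi : (w i).re ≠ 0 := (Finset.mem_filter.1 hi).2
        have hPi : (P i).trace ≠ 0 := fun h => hi (by simp [hwdef, h])
        have hQi : (Q i).trace ≠ 0 := fun h => hi (by simp [hwdef, h])
        refine subset_convexHull _ _ ⟨_, _, ⟨(hP i).smul (inv_nonneg.2 (hP0 i)), ?_⟩,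
          ⟨(hQ i).smul (inv_nonneg.2 (hQ0 i)), ?_⟩, rfl⟩
        · rw [trace_smul, smul_eq_mul, inv_mul_cancel₀ hPi]
        · rw [trace_smul, smul_eq_mul, inv_mul_cancel₀ hQi])
  convert hmem using 1
  rw [Finset.sum_filter_of_ne (p := fun i => (w i).re ≠ 0)
    (fun i _ h h' => h (by rw [h', zero_smul])), hT, Finset.smul_sum]
  refine Finset.sum_congr rfl fun i _ => ?_
  rw [← Complex.coe_smul, hwre, smul_kronecker, kronecker_smul, smul_smul, smul_smul]
  by_cases h : (P i).trace = 0
  · rw [(hP i).trace_eq_zero_iff.1 h]; simp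
  by_cases h' : (Q i).trace = 0
  · rw [(hQ i).trace_eq_zero_iff.1 h']; simp
  congr 1
  rw [hwdef, ← hT]
  field_simp

end Separable

/-! ### The Holevo form of entanglement breaking maps -/

theorem choi_injective : Function.Injective (choi : (M a →ₗ[ℂ] M b) → _) := by
  intro Φ Ψ h
  refine LinearMap.ext fun X => ?_
  have hs : ∀ p q, Φ (single p q 1) = Ψ (single p q 1) := fun p q =>
    Matrix.ext fun i j => congrFun (congrFun h (p, i)) (q, j)
  rw [matrix_eq_sum_single X]
  simp only [map_sum]
  refine Finset.sum_congr rfl fun p _ => Finset.sum_congr rfl fun q _ => ?_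
  rw [← mul_one (X p q), ← smul_eq_mul, ← smul_single, map_smul, map_smul, hs]

theorem exists_eq_smul_unit [NeZero a] (x : Fin a → ℂ) :
    ∃ (α : ℂ) (u : Fin a → ℂ), star u ⬝ᵥ u = 1 ∧ x = α • u := by
  by_cases hx : x = 0
  · exact ⟨0, Pi.single 0 1, by simp [dotProduct, Pi.single_apply], by simp [hx]⟩
  have h0 : 0 < star x ⬝ᵥ x := dotProduct_star_self_pos_iff.2 hx
  obtain ⟨hre, him⟩ := Complex.pos_iff.1 h0
  set r := Real.sqrt (star x ⬝ᵥ x).re with hr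
  have hr0 : (r : ℂ) ≠ 0 := by exact_mod_cast (Real.sqrt_pos.2 hre).ne'
  have hrr : (r : ℂ) * r = star x ⬝ᵥ x := by
    rw [← Complex.ofReal_mul, Real.mul_self_sqrt hre.le]
    apply Complex.ext <;> simp [← him]
  refine ⟨r, (r : ℂ)⁻¹ • x, ?_, by rw [smul_smul, mul_inv_cancel₀ hr0, one_smul]⟩
  rw [star_smul, smul_dotProduct, dotProduct_smul, ← hrr]
  simp
  field_simp

/-- A map has a Holevo form as soon as its Choi matrix is a sum of tensor products of positive
matrices, by decomposing these into rank one matrices. -/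
theorem exists_hasHolevoForm_of_choi {Φ : M a →ₗ[ℂ] M b} {ι : Type} [Fintype ι]
    {P : ι → M a} {Q : ι → M b} (hP : ∀ i, (P i).PosSemidef) (hQ : ∀ i, (Q i).PosSemidef)
    (h : choi Φ = ∑ i, P i ⊗ₖ Q i) :
    ∃ (κ : Type) (_ : Fintype κ) (_ : DecidableEq κ) (u : κ → Fin a → ℂ)
      (V : Matrix (Fin b) κ ℂ), HasHolevoForm Φ u V := by
  classical
  rcases Nat.eq_zero_or_pos a with rfl | ha
  · refine ⟨Empty, inferInstance, inferInstance, fun k => k.elim, 0, fun k => k.elim, fun X => ?_⟩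
    rw [Subsingleton.elim X 0]
    simp
  have : NeZero a := ⟨ha.ne'⟩
  choose B hB using fun i => (hP i).exists_eq_conjTranspose_mul_self
  choose C hC using fun i => (hQ i).exists_eq_conjTranspose_mul_self
  choose α u hu hαu using exists_eq_smul_unit (a := a)
  refine ⟨ι × Fin a × Fin b, inferInstance, inferInstance, fun k => u (B k.1 k.2.1),
    Matrix.of fun s k => α (B k.1 k.2.1) * star (C k.1 k.2.2 s), fun k => hu _, fun X => ?_⟩
  refine LinearMap.congr_fun (g := holevoMap _ _) (choi_injective ?_) X
  rw [choi_holevoMap, h]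
  ext ⟨p, s⟩ ⟨q, t⟩
  rw [Matrix.sum_apply, mul_apply, Fintype.sum_prod_type]
  refine Finset.sum_congr rfl fun i _ => ?_
  rw [kroneckerMap_apply, hB, hC, mul_apply, mul_apply, Fintype.sum_prod_type,
    Finset.sum_mul_sum]
  refine Finset.sum_congr rfl fun r _ => Finset.sum_congr rfl fun l _ => ?_
  have hx : ∀ p, B i r p = α (B i r) * u (B i r) p := fun p => congrFun (hαu (B i r)) p
  simp only [conjTranspose_apply, holevoRoot, of_apply]
  rw [hx p, hx q]
  simp
  ring

theorem IsEntanglementBreaking.exists_hasHolevoForm {Φ : M a →ₗ[ℂ] M b}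
    (h : IsEntanglementBreaking Φ) :
    ∃ (κ : Type) (_ : Fintype κ) (_ : DecidableEq κ) (u : κ → Fin a → ℂ)
      (V : Matrix (Fin b) κ ℂ), HasHolevoForm Φ u V := by
  rcases Nat.eq_zero_or_pos a with rfl | ha
  · refine ⟨Empty, inferInstance, inferInstance, fun k => k.elim, 0, fun k => k.elim, fun X => ?_⟩
    rw [Subsingleton.elim X 0]
    simp
  have ha' : (a : ℂ) ≠ 0 := by exact_mod_cast ha.ne'
  -- The Choi matrix is `a` times the image of the maximally entangled state.
  let e : Fin a × Fin a → ℂ := fun p => if p.1 = p.2 then 1 else 0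
  have hρ : IsState ((a : ℂ)⁻¹ • vecMulVec e (star e)) := by
    refine ⟨(posSemidef_vecMulVec_self_star e).smul (inv_nonneg.2 (Nat.cast_nonneg a)), ?_⟩
    rw [trace_smul, trace_vecMulVec, dotProduct, Fintype.sum_prod_type]
    simp [e, ha']
  obtain ⟨ι, _, P, Q, hP, hQ, hsum⟩ := (h.2 a _ hρ).exists_eq_sum
  refine exists_hasHolevoForm_of_choi (P := fun i => (a : ℂ) • P i) (Q := Q)
    (fun i => (hP i).smul (Nat.cast_nonneg a)) hQ ?_
  simp only [smul_kronecker, ← Finset.smul_sum, ← hsum]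
  ext p q
  have hblock : (Matrix.of fun r s => ((a : ℂ)⁻¹ • vecMulVec e (star e)) (p.1, r) (q.1, s)) =
      (a : ℂ)⁻¹ • (single p.1 q.1 1 : M a) := by
    ext r s
    by_cases h1 : p.1 = r <;> by_cases h2 : q.1 = s <;>
      simp [vecMulVec_apply, e, single, h1, h2]
  rw [Matrix.smul_apply, idTensor, of_apply, hblock, map_smul, Matrix.smul_apply, smul_smul,
    mul_inv_cancel₀ ha', one_smul]
  rfl

theorem HasHolevoForm.isEntanglementBreaking {ι : Type*} [Fintype ι] [DecidableEq ι]
    {Φ : M a →ₗ[ℂ] M b} {u : ι → Fin a → ℂ} {V : Matrix (Fin b) ι ℂ}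
    (h : HasHolevoForm Φ u V) : IsEntanglementBreaking Φ := by
  have key : ∀ (k : ℕ) (X : Matrix (Fin k × Fin a) (Fin k × Fin a) ℂ), X.PosSemidef →
      IsSeparable (idTensor k Φ X) := by
    intro k X hX
    let W : ι → Matrix (Fin k × Fin a) (Fin k) ℂ := fun l =>
      Matrix.of fun p q => if p.1 = q then u l p.2 else 0
    have hsum : idTensor k Φ X =
        ∑ l, ((W l)ᴴ * X * W l) ⊗ₖ vecMulVec (V.col l) (star (V.col l)) := by
      ext p q
      rw [idTensor, of_apply, h.2, mul_apply, Matrix.sum_apply]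
      refine Finset.sum_congr rfl fun l _ => ?_
      have hW : ((W l)ᴴ * X * W l) p.1 q.1 =
          star (u l) ⬝ᵥ (Matrix.of fun r s => X (p.1, r) (q.1, s)) *ᵥ u l := by
        simp only [mul_apply, conjTranspose_apply, W, of_apply, Fintype.sum_prod_type, dotProduct,
          mulVec, apply_ite star, star_zero, ite_mul, mul_ite, zero_mul, mul_zero,
          Pi.star_apply]
        simp [Finset.sum_mul, Finset.mul_sum]
        rw [Finset.sum_comm]
        exact Finset.sum_congr rfl fun _ _ => Finset.sum_congr rfl fun _ _ => by ring
      rw [kroneckerMap_apply, hW, pureDiag_apply, mul_diagonal, vecMulVec_apply]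
      simp
      ring
    rw [hsum]
    exact isSeparable_sum_kronecker (fun l => hX.conjTranspose_mul_mul_same _)
      fun l => posSemidef_vecMulVec_self_star _
  exact ⟨fun k X hX => (key k X hX).1, fun k ρ hρ => key k ρ hρ.1⟩

/-! ### Degradability -/

theorem IsCP.map_posSemidef {Γ : M a →ₗ[ℂ] M b} (h : IsCP Γ) {X : M a} (hX : X.PosSemidef) :
    (Γ X).PosSemidef :=
  (h 1 _ (hX.submatrix Prod.snd)).submatrix fun i => ((0 : Fin 1), i)

theorem IsCP.comp {c : ℕ} {Γ : M b →ₗ[ℂ] M c} {Φ : M a →ₗ[ℂ] M b} (hΓ : IsCP Γ) (hΦ : IsCP Φ) :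
    IsCP (Γ ∘ₗ Φ) := by
  intro k X hX
  have : idTensor k (Γ ∘ₗ Φ) X = idTensor k Γ (idTensor k Φ X) := by
    ext p q
    rfl
  rw [this]
  exact hΓ k _ (hΦ k X hX)

theorem isCP_Ad (V : Matrix (Fin a) (Fin b) ℂ) : IsCP (Ad V) := by
  intro k X hX
  have : idTensor k (Ad V) X = ((1 : M k) ⊗ₖ V)ᴴ * X * ((1 : M k) ⊗ₖ V) := by
    ext ⟨p, i⟩ ⟨q, j⟩
    simp only [idTensor, Ad, LinearMap.coe_mk, AddHom.coe_mk, of_apply, mul_apply,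
      conjTranspose_apply, kroneckerMap_apply, Fintype.sum_prod_type, one_apply]
    simp [apply_ite (starRingEnd ℂ), Finset.sum_ite_irrel]
  rw [this]
  exact hX.conjTranspose_mul_mul_same _

theorem HasHolevoForm.exists_comp {c : ℕ} {ι : Type} [Fintype ι] [DecidableEq ι]
    {Φ : M a →ₗ[ℂ] M b} {u : ι → Fin a → ℂ} {V : Matrix (Fin b) ι ℂ}
    (h : HasHolevoForm Φ u V) {Γ : M b →ₗ[ℂ] M c} (hΓ : IsCP Γ) :
    ∃ (κ : Type) (_ : Fintype κ) (_ : DecidableEq κ) (y : κ → Fin a → ℂ)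
      (Z : Matrix (Fin c) κ ℂ), HasHolevoForm (Γ ∘ₗ Φ) y Z := by
  refine exists_hasHolevoForm_of_choi (P := fun k => vecMulVec (star (u k)) (u k))
    (Q := fun k => Γ (vecMulVec (V.col k) (star (V.col k))))
    (fun k => posSemidef_vecMulVec_star_self _)
    (fun k => hΓ.map_posSemidef (posSemidef_vecMulVec_self_star _)) ?_
  ext p q
  have hΦ : Φ (single p.1 q.1 1) =
      ∑ k, (star (u k p.1) * u k q.1) • vecMulVec (V.col k) (star (V.col k)) := by
    ext i j
    rw [h.2, pureDiag_apply, mul_apply, Matrix.sum_apply]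
    refine Finset.sum_congr rfl fun k _ => ?_
    rw [mul_diagonal, quadForm_single, Matrix.smul_apply, vecMulVec_apply]
    simp
    ring
  rw [choi, of_apply, LinearMap.comp_apply, hΦ, map_sum, Matrix.sum_apply, Matrix.sum_apply]
  refine Finset.sum_congr rfl fun k _ => ?_
  rw [map_smul]
  rfl

/-- Let `A` be a Stinespring operator with `Φ` and `Γ ∘ Φ` as its marginals. Both maps are
entanglement breaking, so that each Choi matrix has at least the rank of its output marginal; and
by duality for the pure tripartite vector given by `A`, the rank of the Choi matrix of `Φ` is that
of the output of `Γ ∘ Φ`, and vice versa. -/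
theorem HasHolevoForm.rank_choi_le_of_isDegradable {ι : Type} [Fintype ι] [DecidableEq ι]
    {Φ : M a →ₗ[ℂ] M b} {u : ι → Fin a → ℂ} {V : Matrix (Fin b) ι ℂ}
    (h : HasHolevoForm Φ u V) (hd : IsDegradable Φ) : (choi Φ).rank ≤ b := by
  obtain ⟨c, Γ, hΓ, -, -, A, hA⟩ := hd
  obtain ⟨κ, _, _, y, Z, hΨ⟩ := h.exists_comp hΓ
  let L : Matrix (Fin a × Fin b) (Fin c) ℂ := Matrix.of fun p e => A (p.2, e) p.1
  let K : Matrix (Fin a × Fin c) (Fin b) ℂ := Matrix.of fun p i => A (i, p.2) p.1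
  have hent : ∀ (r s : Fin a) (i j : Fin b × Fin c),
      (A * (single r s 1 : M a) * Aᴴ) i j = A i r * star (A j s) := by
    intro r s i j
    rw [mul_apply]
    simp [mul_apply, single, ite_and]
  have hL : choi Φ = L * Lᴴ := by
    ext p q
    simp only [choi, of_apply, (hA _).1, trSnd, hent, mul_apply, L, conjTranspose_apply]
  have hK : choi (Γ ∘ₗ Φ) = K * Kᴴ := by
    ext p q
    simp only [choi, of_apply, (hA _).2, trFst, hent, mul_apply, K, conjTranspose_apply]
  have hLt : (Γ ∘ₗ Φ) 1 = Lᵀ * Lᵀᴴ := by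
    ext i j
    rw [(hA _).2, Matrix.mul_one]
    simp only [trFst, of_apply, mul_apply, L, conjTranspose_apply, transpose_apply,
      Fintype.sum_prod_type]
    exact Finset.sum_comm
  calc (choi Φ).rank = ((Γ ∘ₗ Φ) 1).rank := by
        rw [hL, rank_self_mul_conjTranspose, hLt, rank_self_mul_conjTranspose, rank_transpose]
    _ ≤ (choi (Γ ∘ₗ Φ)).rank := hΨ.rank_map_one_le
    _ ≤ b := by
        rw [hK, rank_self_mul_conjTranspose]
        exact K.rank_le_card_width.trans_eq (Fintype.card_fin b)

/-- A measurement in pure states is its own complement, up to a unitary. -/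
theorem HasHolevoForm.isDegradable {Φ : M a →ₗ[ℂ] M b} {w : Fin b → Fin a → ℂ} {E : M b}
    (h : HasHolevoForm Φ w E) (hE : E ∈ unitaryGroup (Fin b) ℂ) : IsDegradable Φ := by
  have hEE : Eᴴ * E = 1 := mem_unitaryGroup_iff'.1 hE
  have hΦE : ∀ X, (Ad E ∘ₗ Φ) X = pureDiag w X := by
    intro X
    change Eᴴ * Φ X * E = _
    rw [h.2]
    calc Eᴴ * (E * pureDiag w X * Eᴴ) * E = (Eᴴ * E) * pureDiag w X * (Eᴴ * E) := by
          simp only [Matrix.mul_assoc]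
      _ = _ := by rw [hEE, Matrix.one_mul, Matrix.mul_one]
  let A : Matrix (Fin b × Fin b) (Fin a) ℂ := Matrix.of fun p r => E p.1 p.2 * star (w p.2 r)
  have hA : ∀ (X : M a) (p q : Fin b × Fin b), (A * X * Aᴴ) p q =
      E p.1 p.2 * star (E q.1 q.2) * (star (w p.2) ⬝ᵥ X *ᵥ w q.2) := by
    intro X p q
    rw [dotProduct_mulVec]
    simp only [mul_apply, A, of_apply, conjTranspose_apply, dotProduct, vecMul, Finset.mul_sum,
      Finset.sum_mul, star_mul', star_star, Pi.star_apply]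
    exact Finset.sum_congr rfl fun _ _ => Finset.sum_congr rfl fun _ _ => by ring
  refine ⟨b, Ad E, isCP_Ad E, h.isEntanglementBreaking.1,
    (isCP_Ad E).comp h.isEntanglementBreaking.1, A, fun X => ⟨?_, ?_⟩⟩
  · ext i j
    rw [h.2, pureDiag_apply, mul_apply, trSnd, of_apply]
    refine Finset.sum_congr rfl fun s _ => ?_
    rw [hA, mul_diagonal, conjTranspose_apply]
    ring
  · rw [hΦE]
    ext s t
    have hst := congrFun (congrFun hEE t) s
    simp only [mul_apply, conjTranspose_apply] at hst
    simp only [trFst, of_apply, hA, ← Finset.sum_mul]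
    simp only [mul_comm (E _ s), hst, pureDiag_apply, one_apply, diagonal_apply, eq_comm (a := t)]
    split_ifs with hs
    · rw [hs, one_mul]
    · rw [zero_mul]

/-! ### `C*`-extreme points -/

theorem quadForm_vecMulVec (u p : Fin a → ℂ) :
    star u ⬝ᵥ vecMulVec p (star p) *ᵥ u = star (star u ⬝ᵥ p) * (star u ⬝ᵥ p) := by
  rw [vecMulVec_mulVec, dotProduct_smul, star_dotProduct p, op_smul_eq_smul, smul_eq_mul]

/-- A unit vector orthogonal to everything orthogonal to `u` gives the same pure state as `u`. -/
theorem quadForm_eq_of_orthogonal {u y : Fin a → ℂ} (hu : star u ⬝ᵥ u = 1)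
    (hy : star y ⬝ᵥ y = 1) (h : ∀ p : Fin a → ℂ, star u ⬝ᵥ p = 0 → star y ⬝ᵥ p = 0)
    (X : M a) : star y ⬝ᵥ X *ᵥ y = star u ⬝ᵥ X *ᵥ u := by
  set c := star u ⬝ᵥ y
  have hp : star u ⬝ᵥ (y - c • u) = 0 := by
    rw [dotProduct_sub, dotProduct_smul, hu, smul_eq_mul, mul_one, sub_self]
  have h0 : star (y - c • u) ⬝ᵥ (y - c • u) = 0 := by
    rw [star_sub, sub_dotProduct, h _ hp, star_smul, smul_dotProduct, hp, smul_zero, sub_zero]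
  rw [dotProduct_star_self_eq_zero, sub_eq_zero] at h0
  exact quadForm_eq_of_smul_eq hu hy one_ne_zero (by rw [one_smul]; exact h0) X

theorem HasHolevoForm.mem_UEB {ι : Type*} [Fintype ι] [DecidableEq ι] {Φ : M a →ₗ[ℂ] M b}
    {u : ι → Fin a → ℂ} {V : Matrix (Fin b) ι ℂ} (h : HasHolevoForm Φ u V) (hV : V * Vᴴ = 1) :
    Φ ∈ UEB a b :=
  ⟨h.isEntanglementBreaking, by rw [h.map_one, hV]⟩

theorem HasHolevoForm.isCStarExtremeUEB {Φ : M a →ₗ[ℂ] M b} {w : Fin b → Fin a → ℂ} {E : M b}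
    (h : HasHolevoForm Φ w E) (hE : E ∈ unitaryGroup (Fin b) ℂ) : IsCStarExtremeUEB Φ := by
  have hEE : Eᴴ * E = 1 := mem_unitaryGroup_iff'.1 hE
  have hEE' : E * Eᴴ = 1 := mem_unitaryGroup_iff.1 hE
  refine ⟨h.mem_UEB hEE', fun n T Ψ hT _ hΨ hsum i => ?_⟩
  obtain ⟨κ, _, _, y, Z, hZ⟩ := (hΨ i).1.exists_hasHolevoForm
  have hGu : IsUnit (Eᴴ * (T i)ᴴ) := by
    refine IsUnit.mul ?_ (hT i).star
    exact (Matrix.isUnit_iff_isUnit_det _).2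
      (isUnit_det_of_right_inverse hEE)
  obtain ⟨E', hE', hΨE⟩ := hZ.exists_unitary (hΨ i).2 hGu (u := w) (by
    intro j k hjk
    refine quadForm_eq_of_orthogonal (h.1 j) (hZ.1 k) fun p hp => ?_
    -- Evaluate at `X = p p*` the `j`-th diagonal entry in the basis given by `E`.
    set X := vecMulVec p (star p) with hX
    have hXpos : X.PosSemidef := posSemidef_vecMulVec_self_star p
    have hdecomp : Eᴴ * Φ X * E =
        ∑ l, (Eᴴ * (T l)ᴴ) * Ψ l X * (Eᴴ * (T l)ᴴ)ᴴ := by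
      conv_lhs => rw [hsum]
      simp only [LinearMap.sum_apply, Matrix.mul_sum, Matrix.sum_mul]
      refine Finset.sum_congr rfl fun l _ => ?_
      change Eᴴ * ((T l)ᴴ * Ψ l X * T l) * E = _
      simp only [conjTranspose_mul, conjTranspose_conjTranspose, Matrix.mul_assoc]
    have hzero : (Eᴴ * Φ X * E) j j = 0 := by
      have : Eᴴ * Φ X * E = (Eᴴ * E) * pureDiag w X * (Eᴴ * E) := by
        rw [h.2]; simp only [Matrix.mul_assoc]
      rw [this, hEE, Matrix.one_mul, Matrix.mul_one, pureDiag_apply, diagonal_apply_eq, hX,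
        quadForm_vecMulVec, hp, mul_zero]
    have hpos : ∀ l, 0 ≤ ((Eᴴ * (T l)ᴴ) * Ψ l X * (Eᴴ * (T l)ᴴ)ᴴ) j j := fun l =>
      (((hΨ l).1.1.map_posSemidef hXpos).mul_mul_conjTranspose_same _).diag_nonneg
    rw [hdecomp, Matrix.sum_apply, Finset.sum_eq_zero_iff_of_nonneg fun l _ => hpos l] at hzero
    have hi := hzero i (Finset.mem_univ i)
    have hexp : ((Eᴴ * (T i)ᴴ) * Ψ i X * (Eᴴ * (T i)ᴴ)ᴴ) j j =
        ∑ k, star (star (y k) ⬝ᵥ p * star ((Eᴴ * (T i)ᴴ * Z) j k)) *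
          (star (y k) ⬝ᵥ p * star ((Eᴴ * (T i)ᴴ * Z) j k)) := by
      have : (Eᴴ * (T i)ᴴ) * Ψ i X * (Eᴴ * (T i)ᴴ)ᴴ =
          (Eᴴ * (T i)ᴴ * Z) * pureDiag y X * (Eᴴ * (T i)ᴴ * Z)ᴴ := by
        rw [hZ.2, conjTranspose_mul (Eᴴ * (T i)ᴴ) Z]; simp only [Matrix.mul_assoc]
      rw [this, mul_apply, pureDiag_apply]
      refine Finset.sum_congr rfl fun k _ => ?_
      rw [mul_diagonal, hX, quadForm_vecMulVec, conjTranspose_apply, star_mul', star_star]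
      ring
    rw [hexp, Finset.sum_eq_zero_iff_of_nonneg fun k _ => star_mul_self_nonneg _] at hi
    have hk := hi k (Finset.mem_univ k)
    rw [mul_eq_zero, star_eq_zero, or_self, mul_eq_zero, star_eq_zero] at hk
    exact hk.resolve_right hjk)
  refine ⟨E * E'ᴴ, mul_mem hE (Unitary.star_mem hE'), LinearMap.ext fun X => ?_⟩
  change Ψ i X = (E * E'ᴴ)ᴴ * Φ X * (E * E'ᴴ)
  rw [hΨE, h.2, conjTranspose_mul, conjTranspose_conjTranspose]
  calc E' * pureDiag w X * E'ᴴ = E' * (Eᴴ * E) * pureDiag w X * (Eᴴ * E) * E'ᴴ := by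
        rw [hEE, Matrix.mul_one, Matrix.mul_one]
    _ = _ := by simp only [Matrix.mul_assoc]

/-- Write `Φ` as a sum of two maps: half of its terms along a basis chosen among the `v_k`, and
the rest. The first is the compression, by an invertible matrix, of a measurement in the standard
basis; the second has invertible value at `1`, and normalizes to a unital map. So extremality makes
`Φ` unitarily equivalent to the measurement. -/
theorem HasHolevoForm.exists_unitary_of_isCStarExtremeUEB {ι : Type*} [Fintype ι]
    [DecidableEq ι] {Φ : M a →ₗ[ℂ] M b} {u : ι → Fin a → ℂ} {V : Matrix (Fin b) ι ℂ}
    (h : HasHolevoForm Φ u V) (hext : IsCStarExtremeUEB Φ) :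
    ∃ (w : Fin b → Fin a → ℂ) (E : M b), E ∈ unitaryGroup (Fin b) ℂ ∧ HasHolevoForm Φ w E := by
  classical
  have h1 : Φ 1 = 1 := hext.1.2
  have hVV : V * Vᴴ = 1 := by rw [← h.map_one, h1]
  obtain ⟨f, hf, -, hB⟩ := h.exists_basis h1
  set B := V.submatrix id f with hBdef
  obtain ⟨c, hc, hcc, hc0⟩ : ∃ c : ℂ, star c = c ∧ c * c = 1 / 2 ∧ c ≠ 0 := by
    have hs : ((√(1 / 2) : ℝ) : ℂ) * (√(1 / 2) : ℝ) = 1 / 2 := by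
      rw [← Complex.ofReal_mul, Real.mul_self_sqrt (by norm_num)]; norm_num
    exact ⟨(√(1 / 2) : ℝ), Complex.conj_ofReal _, hs, fun h0 => by
      rw [h0] at hs; norm_num at hs⟩
  let d : ι → ℂ := fun k => if k ∈ Set.range f then c else 1
  have hd0 : ∀ k, d k ≠ 0 := fun k => by
    by_cases hk : k ∈ Set.range f
    · simpa only [d, if_pos hk] using hc0
    · simp only [d, if_neg hk, ne_eq, one_ne_zero, not_false_eq_true]
  set V' := V * diagonal d with hV'
  have hsplit : ∀ X, Φ X = (c • Bᴴ)ᴴ * pureDiag (u ∘ f) X * (c • Bᴴ) +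
      V' * pureDiag u X * V'ᴴ := by
    intro X
    ext i j
    rw [h.2, Matrix.add_apply, mul_apply, mul_apply, mul_apply]
    have hsum : ∑ s, ((c • Bᴴ)ᴴ * pureDiag (u ∘ f) X) i s * (c • Bᴴ) s j =
        ∑ k, if k ∈ Set.range f then 1 / 2 * ((V * pureDiag u X) i k * Vᴴ k j) else 0 := by
      refine Fintype.sum_of_injective f hf _ _ (fun k hk => if_neg hk) fun s => ?_
      rw [if_pos ⟨s, rfl⟩, conjTranspose_smul, conjTranspose_conjTranspose, pureDiag_apply,
        pureDiag_apply, mul_diagonal, mul_diagonal, hc, ← hcc]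
      simp only [Matrix.smul_apply, conjTranspose_apply, hBdef, submatrix_apply, id,
        Function.comp, smul_eq_mul]
      ring
    rw [hsum, ← Finset.sum_add_distrib]
    refine Finset.sum_congr rfl fun k _ => ?_
    simp only [hV', pureDiag_apply, mul_diagonal, conjTranspose_apply, d, star_mul']
    split_ifs
    · rw [hc]
      linear_combination (-(V i k * (star (u k) ⬝ᵥ X *ᵥ u k) * star (V j k))) * hcc
    · rw [star_one]; ring
  have hpos : (V' * V'ᴴ).PosDef := by
    refine PosDef.mul_conjTranspose_self _ fun x y hxy => ?_
    have hinv : V' * (diagonal (fun k => (d k)⁻¹) * Vᴴ) = 1 := by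
      rw [hV', Matrix.mul_assoc, ← Matrix.mul_assoc (diagonal d), diagonal_mul_diagonal]
      simp only [mul_inv_cancel₀ (hd0 _), diagonal_one, Matrix.one_mul, hVV]
    have := congrArg (fun z => z ᵥ* (diagonal (fun k => (d k)⁻¹) * Vᴴ)) hxy
    simpa only [vecMul_vecMul, hinv, vecMul_one] using this
  obtain ⟨R, hRu, hRs, hRR, -⟩ := exists_sqrt hpos
  have hRd := (isUnit_iff_isUnit_det R).1 hRu
  have hR1 : R⁻¹ * R = 1 := nonsing_inv_mul R hRd
  have hR2 : R * R⁻¹ = 1 := mul_nonsing_inv R hRd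
  have hRi : (R⁻¹)ᴴ = R⁻¹ := by rw [conjTranspose_nonsing_inv, hRs]
  have hΦ₁ : HasHolevoForm (holevoMap (u ∘ f) (1 : M b)) (u ∘ f) 1 :=
    ⟨fun k => h.1 _, fun X => rfl⟩
  have hΦ₂ : HasHolevoForm (holevoMap u (R⁻¹ * V')) u (R⁻¹ * V') := ⟨h.1, fun X => rfl⟩
  have hcu : IsUnit (c • Bᴴ) := by
    have : c • Bᴴ = (Units.mk0 c hc0) • Bᴴ := rfl
    rw [this, isUnit_smul_iff]
    exact hB.star
  obtain ⟨U, hU, hUΦ⟩ := hext.2 2 ![c • Bᴴ, R]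
    ![holevoMap (u ∘ f) 1, holevoMap u (R⁻¹ * V')]
    (by
      intro i
      fin_cases i
      · exact hcu
      · exact hRu)
    (by
      have := hsplit 1
      rw [h1, pureDiag_one h.1, pureDiag_one (u := u ∘ f) fun k => h.1 _, Matrix.mul_one,
        Matrix.mul_one] at this
      simp [Fin.sum_univ_two, this, hRs, hRR])
    (by
      intro i
      fin_cases i
      · exact hΦ₁.mem_UEB (by simp)
      · refine hΦ₂.mem_UEB ?_
        rw [conjTranspose_mul R⁻¹, hRi]
        calc R⁻¹ * V' * (V'ᴴ * R⁻¹) = R⁻¹ * (V' * V'ᴴ) * R⁻¹ := by simp only [Matrix.mul_assoc]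
          _ = (R⁻¹ * R) * (R * R⁻¹) := by rw [← hRR]; simp only [Matrix.mul_assoc]
          _ = 1 := by rw [hR1, hR2, Matrix.mul_one])
    (by
      refine LinearMap.ext fun X => ?_
      rw [hsplit X, Fin.sum_univ_two]
      change _ = (c • Bᴴ)ᴴ * (1 * pureDiag (u ∘ f) X * 1ᴴ) * (c • Bᴴ) +
        Rᴴ * (R⁻¹ * V' * pureDiag u X * (R⁻¹ * V')ᴴ) * R
      rw [conjTranspose_one, Matrix.one_mul, Matrix.mul_one]
      congr 1
      rw [conjTranspose_mul R⁻¹, hRi, hRs]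
      calc V' * pureDiag u X * V'ᴴ = (R * R⁻¹) * V' * pureDiag u X * V'ᴴ * (R⁻¹ * R) := by
            rw [hR1, hR2, Matrix.one_mul, Matrix.mul_one]
        _ = _ := by simp only [Matrix.mul_assoc]) 0
  have hUU : U * Uᴴ = 1 := mem_unitaryGroup_iff.1 hU
  refine ⟨u ∘ f, U, hU, fun k => h.1 _, fun X => ?_⟩
  have hX : 1 * pureDiag (u ∘ f) X * 1ᴴ = Uᴴ * Φ X * U := LinearMap.congr_fun hUΦ X
  rw [conjTranspose_one, Matrix.one_mul, Matrix.mul_one] at hX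
  rw [hX]
  calc Φ X = (U * Uᴴ) * Φ X * (U * Uᴴ) := by rw [hUU, Matrix.one_mul, Matrix.mul_one]
    _ = _ := by simp only [Matrix.mul_assoc]

end UEBMaps

end

theorem theorem4p1 (d₁ d₂ : ℕ) (Φ : UEBMaps.M d₁ →ₗ[ℂ] UEBMaps.M d₂)
    (hΦ : Φ ∈ UEBMaps.UEB d₁ d₂) :
    UEBMaps.IsDegradable Φ ↔ UEBMaps.IsCStarExtremeUEB Φ := by
  obtain ⟨ι, _, _, u, V, h⟩ := hΦ.1.exists_hasHolevoForm
  constructor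
  · intro hd
    obtain ⟨w, E, hE, hΦE⟩ :=
      h.exists_unitary_of_rank_le hΦ.2 (h.rank_choi_le_of_isDegradable hd)
    exact hΦE.isCStarExtremeUEB hE
  · intro hext
    obtain ⟨w, E, hE, hΦE⟩ := h.exists_unitary_of_isCStarExtremeUEB hext
    exact hΦE.isDegradable hE
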